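/- **Setting.** Let $\mathcal A=\{A_0,\dots,A_d\}$ be a commutative association scheme (not necessarily symmetric) with $d$ classes on a finite vertex set $V$, $|V|=v$: the $A_i$ are nonzero $01$-matrices with $A_0=I$, $\sum_i A_i=J$, closed under transposition, pairwise commuting, with every $A_iA_j$ in the span of $A_0,\dots,A_d$. Let $E_0=\frac1vJ,E_1,\dots,E_d$ be its principal idempotents, i.e. the nonzero, pairwise orthogonal, Hermitian idempotents with sum $I$ in the span of the $A_i$. Suppose that $\mathcal A$ is a translation scheme: an abelian group $\Gamma$ (written additively) of permutations of $V$, transitive on $V$, preserves every $A_i$. Fixing a base vertex $o\in V$ identifies $g\in\Gamma$ with the vertex $g+o$. *The scheme $H(n,\mathcal A)$.* For $u,w\in V^n$ let $h(u,w)=(h_0,\dots,h_d)$, where $h_r$ is the number of coordinates $k$ such that $u_k,w_k$ are $r$-related. For $\alpha\in\mathbb Z_{\ge0}^{d+1}$ with $|\alpha|:=\sum_r\alpha_r=n$, let $A_\alpha$ be the $01$-matrix on $V^n$ with $(A_\alpha)_{u,w}=1$ iff $h(u,w)=\alpha$, and let $E_\alpha$ be the sum of all products $E_{i_1}\otimes\cdots\otimes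 E_{i_n}$ in which each $E_r$ occurs exactly $\alpha_r$ times. For a nonempty $C\subseteq V^n$ with characteristic vector $x$, the weight enumerator and the dual weight enumerator are $$W_C(t)=\frac1{|C|}\sum_{|\alpha|=n}(x^TA_\alpha x)\,t^\alpha,\qquad W_C^\perp(t)=\frac{v^n}{|C|^2}\sum_{|\beta|=n}(x^TE_\beta x)\,t^\beta,\qquad t^\alpha=\prod_{r=0}^d t_r^{\alpha_r}.$$ *Duals.* Fix a base vertex $b\in V^n$. The set $C\subseteq V^n$ is additive if $\{g\in\Gamma^n: g+b\in C\}$ is a subgroup of $\Gamma^n$. Let $\Gamma^*$ be the group of complex characters of $\Gamma$, and identify $(\Gamma^*)^n$ with the character group of $\Gamma^n$ by $\chi(g)=\prod_k\chi_k(g_k)$. The dual of $C$ is $$C^\perp=\{\chi\in(\Gamma^*)^n:\ \chi(g)=1\text{ for all }g\in\Gamma^n\text{ with }g+b\in C\}.$$ The dual $\mathcal A^*$ of $\mathcal A$ has vertex set $\Gamma^*$; the characters $\chi,\psi$ are $j$-related in $\mathcal A^*$ iff $E_j(\chi\psi^{-1})=\chi\psi^{-1}$, where characters are regarded as functions on $V$.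 The dual $C^\perp$ is a set of vertices of $H(n,\mathcal A^*)$. **Theorem.** (1) $\mathcal A^*$ is a commutative association scheme with $d$ classes on $\Gamma^*$. (2) For every $n\ge0$, every base vertex $b\in V^n$ and every additive subset $C$ of $H(n,\mathcal A)$, $$W_{C^\perp}(t)=W^\perp_C(t),$$ where $W_{C^\perp}$ is the weight enumerator of $C^\perp$ in $H(n,\mathcal A^*)$. (3) In particular, let $\varphi:\Gamma^*\to\Gamma$ be a group isomorphism such that, for all $j$, the characters $\chi,\psi$ are $j$-related in $\mathcal A^*$ iff the vertices $\varphi(\chi)+o$ and $\varphi(\psi)+o$ are $j$-related in $\mathcal A$. Identify $C^\perp$ with the subset $\{(\varphi(\chi_k)+b_k)_{k}:\chi\in C^\perp\}$ of the vertices of $H(n,\mathcal A)$. Then the equality in (2) also holds when $W_{C^\perp}$ is computed in $H(n,\mathcal A)$. -/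

import Mathlib

namespace TranslationDuality

open Matrix

open Classical in
/-- `A 0, …, A d` are the (nonempty) relations, as `01`-matrices, of a commutative association
scheme with `d` classes on `V`. The scheme need not be symmetric. -/
structure IsAssociationScheme {V : Type*} [Fintype V] {d : ℕ}
    (A : Fin (d + 1) → Matrix V V ℂ) : Prop where
  zero_or_one : ∀ i u w, A i u w = 0 ∨ A i u w = 1
  ne_zero : ∀ i, A i ≠ 0
  zero_eq_one : A 0 = 1
  sum_eq : ∑ i, A i = Matrix.of fun _ _ => (1 : ℂ)
  transpose_mem : ∀ i, ∃ j, (A i)ᵀ = A j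
  mul_eq : ∃ p : Fin (d + 1) → Fin (d + 1) → Fin (d + 1) → ℂ,
    ∀ i j, A i * A j = ∑ r, p i j r • A r
  mul_comm : ∀ i j, A i * A j = A j * A i

/-- The Bose–Mesner algebra, as a complex vector space of matrices. -/
def boseMesner {V : Type*} {d : ℕ} (A : Fin (d + 1) → Matrix V V ℂ) :
    Submodule ℂ (Matrix V V ℂ) :=
  Submodule.span ℂ (Set.range A)

open Classical in
/-- `E 0, …, E d` is an enumeration of the principal idempotents of the scheme `A`, starting
with `J / v`: nonzero, pairwise orthogonal, orthogonal projections in the Bose–Mesner algebra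
with sum `I`. Since there are `d + 1` of them, they are a basis of that algebra. -/
structure IsPrincipalIdempotents {V : Type*} [Fintype V] {d : ℕ}
    (A E : Fin (d + 1) → Matrix V V ℂ) : Prop where
  mem : ∀ j, E j ∈ boseMesner A
  ne_zero : ∀ j, E j ≠ 0
  isHermitian : ∀ j, (E j).IsHermitian
  zero_eq : E 0 = Matrix.of fun _ _ => (1 / (Fintype.card V : ℂ))
  sum_eq : ∑ j, E j = 1
  mul_self : ∀ j, E j * E j = E j
  mul_of_ne : ∀ i j, i ≠ j → E i * E j = 0

/-- The group `Γ`, written additively, acts on `V` by automorphisms of every relation of `A`. -/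
def ActsByAutomorphisms (Γ : Type*) {V : Type*} [AddCommGroup Γ] [AddAction Γ V] {d : ℕ}
    (A : Fin (d + 1) → Matrix V V ℂ) : Prop :=
  ∀ (g : Γ) i u w, A i (g +ᵥ u) (g +ᵥ w) = A i u w

/-! ### The scheme `H(n, A)` and the two weight enumerators -/

open Classical in
/-- The vector `h(v, w)`: its `r`-th entry is the number of coordinates `k` such that `v k` and
`w k` are `r`-related. -/
noncomputable def relCount {V : Type*} {d n : ℕ} (A : Fin (d + 1) → Matrix V V ℂ)
    (v w : Fin n → V) : Fin (d + 1) → ℕ :=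
  fun r => (Finset.univ.filter fun k => A r (v k) (w k) = 1).card

open Classical in
/-- The matrix `A_α` of `H(n, A)`: the `(v, w)` entry is `1` iff `h(v, w) = α`. -/
noncomputable def hammingMatrix {V : Type*} {d : ℕ} (n : ℕ) (A : Fin (d + 1) → Matrix V V ℂ)
    (α : Fin (d + 1) → ℕ) : Matrix (Fin n → V) (Fin n → V) ℂ :=
  Matrix.of fun v w => if relCount A v w = α then 1 else 0

open Classical in
/-- The matrix `E_β`: the sum of all tensor products `E (i 1) ⊗ ⋯ ⊗ E (i n)` in which `E r`
occurs exactly `β r` times, for each `r`. -/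
noncomputable def hammingIdempotent {V : Type*} {d : ℕ} (n : ℕ) (E : Fin (d + 1) → Matrix V V ℂ)
    (β : Fin (d + 1) → ℕ) : Matrix (Fin n → V) (Fin n → V) ℂ :=
  ∑ i ∈ Finset.univ.filter
      (fun i : Fin n → Fin (d + 1) => ∀ r, (Finset.univ.filter fun k => i k = r).card = β r),
    Matrix.of fun v w => ∏ k, E (i k) (v k) (w k)

/-- The characteristic vector of a set of vertices. -/
noncomputable def charVec {W : Type*} (C : Set W) : W → ℂ :=
  C.indicator fun _ => 1

/-- The weight enumerator `W_C` of a set `C` of vertices of `H(n, A)`. -/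
noncomputable def weightEnumerator {V : Type*} [Fintype V] {d n : ℕ}
    (A : Fin (d + 1) → Matrix V V ℂ) (C : Set (Fin n → V)) : MvPolynomial (Fin (d + 1)) ℂ :=
  MvPolynomial.C (1 / (C.ncard : ℂ)) *
    ∑ α ∈ Finset.piAntidiag Finset.univ n,
      MvPolynomial.C (charVec C ⬝ᵥ (hammingMatrix n A α *ᵥ charVec C)) *
        ∏ r, MvPolynomial.X r ^ α r

/-- The dual weight enumerator `W_C^⊥` of a set `C` of vertices of `H(n, A)`, where `E` is the
family of principal idempotents of `A`. -/
noncomputable def dualWeightEnumerator {V : Type*} [Fintype V] {d n : ℕ}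
    (E : Fin (d + 1) → Matrix V V ℂ) (C : Set (Fin n → V)) : MvPolynomial (Fin (d + 1)) ℂ :=
  MvPolynomial.C ((Fintype.card V : ℂ) ^ n / (C.ncard : ℂ) ^ 2) *
    ∑ β ∈ Finset.piAntidiag Finset.univ n,
      MvPolynomial.C (charVec C ⬝ᵥ (hammingIdempotent n E β *ᵥ charVec C)) *
        ∏ r, MvPolynomial.X r ^ β r

/-! ### Translation schemes, additive sets and duals

`Γ` acts regularly on `V`, and `g : Γ` is identified with the vertex `g +ᵥ o`. -/

/-- The set of vertices `C` of `H(n, A)` is additive relative to `Γ ^ n` and the base vertex `b`: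
the set of `g` in `Γ ^ n` with `g +ᵥ b ∈ C` is a subgroup. -/
def IsAdditive (Γ : Type*) {V : Type*} [AddCommGroup Γ] [AddAction Γ V] {n : ℕ}
    (b : Fin n → V) (C : Set (Fin n → V)) : Prop :=
  ∃ H : AddSubgroup (Fin n → Γ), ∀ g : Fin n → Γ, g ∈ H ↔ (fun k => g k +ᵥ b k) ∈ C

/-- The dual `C^⊥`: the set of characters of `Γ ^ n` that are trivial on (the image in `Γ ^ n` of)
`C`. A character of `Γ ^ n` is written as the tuple `χ` of its components, so that its value
at `g` is `∏ k, χ k (g k)`. -/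
def dualSet (Γ : Type*) {V : Type*} [AddCommGroup Γ] [AddAction Γ V] {n : ℕ}
    (b : Fin n → V) (C : Set (Fin n → V)) : Set (Fin n → AddChar Γ ℂ) :=
  {χ | ∀ g : Fin n → Γ, (fun k => g k +ᵥ b k) ∈ C → ∏ k, χ k (g k) = 1}

/-- The set `D` of characters of `Γ` that, as functions on `V ≅ Γ`, are fixed by the matrix `M`:
`M χ = χ`. -/
noncomputable def dualClass {Γ V : Type*} [AddCommGroup Γ] [Finite Γ] [AddAction Γ V]
    (o : V) (M : Matrix V V ℂ) : Set (AddChar Γ ℂ) :=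
  {χ | ∀ g : Γ, ∑ᶠ h : Γ, M (g +ᵥ o) (h +ᵥ o) * χ h = χ g}

open Classical in
/-- The dual translation scheme on the character group of `Γ`: the characters `χ`, `ψ` are
`j`-related iff `χ ψ⁻¹` is, as a function on `V`, in the `j`-th eigenspace (the column space
of `E j`). -/
noncomputable def dualScheme (Γ : Type*) {V : Type*} [AddCommGroup Γ] [Finite Γ] [AddAction Γ V]
    {d : ℕ} (o : V) (E : Fin (d + 1) → Matrix V V ℂ) :
    Fin (d + 1) → Matrix (AddChar Γ ℂ) (AddChar Γ ℂ) ℂ :=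
  fun j => Matrix.of fun χ ψ => if χ * ψ⁻¹ ∈ dualClass o (E j) then 1 else 0

/-- The set of vertices of `H(n, A)` that corresponds to a set `D` of `n`-tuples of characters of
`Γ` under an identification `φ` of the character group of `Γ` with `Γ`. -/
def vertexSet {Γ V : Type*} [AddCommGroup Γ] [AddAction Γ V] {n : ℕ}
    (b : Fin n → V) (φ : AddChar Γ ℂ ≃+ Γ) (D : Set (Fin n → AddChar Γ ℂ)) :
    Set (Fin n → V) :=
  (fun χ k => φ (χ k) +ᵥ b k) '' D

end TranslationDuality

/-!
A matrix `M` invariant under the regular abelian group `Γ` has every character `χ` of `Γ` as an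
eigenvector, and the eigenvalues of `M` are its Fourier coefficients. On the idempotents `E j`
they are `0` or `1`, so they partition the characters into the classes `j`. As a function of `χ`,
an eigenvalue of a matrix of the Bose–Mesner algebra depends only on the class of `χ`. The Fourier
transform turns the entrywise product into convolution and the transpose into inversion of
characters, so the closure of the Bose–Mesner algebra under these two operations makes the classes
an association scheme on the characters.

For the weight enumerators, `W_C^⊥` is a sum over pairs of elements of `C` of products of the
entries of `∑ r, t r • E r`. Fourier inversion writes it as a sum over all tuples of characters,
and summing over `C` first leaves, by orthogonality, only the tuples in `C^⊥`. Since `C^⊥` is a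
group and the dual scheme is invariant under translations, the remaining sum is the weight
enumerator of `C^⊥`.
-/

namespace TranslationDuality

open Matrix

section RegularAction

variable {Γ V : Type*} [AddCommGroup Γ] [AddAction Γ V]

theorem vadd_bijective [FaithfulVAdd Γ V] [AddAction.IsPretransitive Γ V] (o : V) :
    Function.Bijective fun g : Γ => g +ᵥ o := by
  refine ⟨fun g h hgh => FaithfulVAdd.eq_of_vadd_eq_vadd fun u : V => ?_,
    AddAction.exists_vadd_eq Γ o⟩
  obtain ⟨x, rfl⟩ := AddAction.exists_vadd_eq Γ o u
  rw [vadd_comm g x o, vadd_comm h x o]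
  exact congrArg (x +ᵥ ·) hgh

theorem card_eq_card_of_regular [Fintype Γ] [Fintype V] [FaithfulVAdd Γ V]
    [AddAction.IsPretransitive Γ V] (o : V) : Fintype.card V = Fintype.card Γ :=
  (Fintype.card_of_bijective (vadd_bijective (Γ := Γ) o)).symm

variable (Γ V) in
/-- The space of complex matrices on `V` that are invariant under the simultaneous action of `Γ`
on rows and columns. It contains the Bose–Mesner algebra of every scheme on which `Γ` acts by
automorphisms. -/
def invariantMatrices : Submodule ℂ (Matrix V V ℂ) where
  carrier := {M | ∀ (g : Γ) u w, M (g +ᵥ u) (g +ᵥ w) = M u w}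
  add_mem' hM hN g u w := congrArg₂ (· + ·) (hM g u w) (hN g u w)
  zero_mem' _ _ _ := rfl
  smul_mem' a _ hM g u w := congrArg (a • ·) (hM g u w)

theorem ActsByAutomorphisms.boseMesner_le {d : ℕ} {A : Fin (d + 1) → Matrix V V ℂ}
    (hΓ : ActsByAutomorphisms Γ A) : boseMesner A ≤ invariantMatrices Γ V :=
  Submodule.span_le.2 <| Set.range_subset_iff.2 fun i g => hΓ g i

theorem apply_vadd_vadd_of_mem_invariantMatrices [AddAction.IsPretransitive Γ V]
    {M : Matrix V V ℂ} (hM : M ∈ invariantMatrices Γ V) (o b : V) (g h : Γ) :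
    M (g +ᵥ b) (h +ᵥ b) = M o ((h - g) +ᵥ o) := by
  obtain ⟨x, rfl⟩ := AddAction.exists_vadd_eq Γ o b
  rw [← hM (g + x) o, vadd_vadd, vadd_vadd, vadd_vadd]
  congr 2
  abel

theorem ActsByAutomorphisms.apply_vadd_vadd_eq [AddAction.IsPretransitive Γ V] {d : ℕ}
    {A : Fin (d + 1) → Matrix V V ℂ} (hΓ : ActsByAutomorphisms Γ A) (j : Fin (d + 1)) (o b : V)
    (g h : Γ) : A j (g +ᵥ o) (h +ᵥ o) = A j (g +ᵥ b) (h +ᵥ b) := by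
  obtain ⟨x, rfl⟩ := AddAction.exists_vadd_eq Γ o b
  rw [vadd_comm g x o, vadd_comm h x o, hΓ]

end RegularAction

section Eigenvalue

variable {Γ V : Type*} [AddCommGroup Γ] [Fintype Γ] [AddAction Γ V]

/-- The eigenvalue of a `Γ`-invariant matrix at the character `χ`, regarded as a function on `V`.
For an arbitrary matrix it is just the Fourier coefficient at `χ` of the row of the base
vertex `o`. -/
noncomputable def eigenvalue (o : V) (χ : AddChar Γ ℂ) : Matrix V V ℂ →ₗ[ℂ] ℂ :=
  ∑ k : Γ, χ k • Matrix.entryLinearMap ℂ ℂ o (k +ᵥ o)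

theorem eigenvalue_apply (o : V) (χ : AddChar Γ ℂ) (M : Matrix V V ℂ) :
    eigenvalue o χ M = ∑ k : Γ, M o (k +ᵥ o) * χ k := by
  simp [eigenvalue, mul_comm]

theorem eigenvalue_one [FaithfulVAdd Γ V] [AddAction.IsPretransitive Γ V] [DecidableEq V]
    (o : V) (χ : AddChar Γ ℂ) : eigenvalue o χ (1 : Matrix V V ℂ) = 1 := by
  classical
  have entry (k : Γ) : (1 : Matrix V V ℂ) o (k +ᵥ o) = if k = 0 then 1 else 0 := by
    rw [one_apply]
    refine if_congr ?_ rfl rfl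
    rw [eq_comm, ← (vadd_bijective (Γ := Γ) o).injective.eq_iff, zero_vadd]
  simp [eigenvalue_apply, entry]

theorem card_mul_apply_eq_sum_eigenvalue (o : V) (M : Matrix V V ℂ) (k : Γ) :
    (Fintype.card Γ : ℂ) * M o (k +ᵥ o) = ∑ χ : AddChar Γ ℂ, eigenvalue o χ M * χ (-k) := by
  classical
  simp only [eigenvalue_apply, Finset.sum_mul, mul_assoc, ← AddChar.map_add_eq_mul]
  rw [Finset.sum_comm]
  simp only [← Finset.mul_sum, AddChar.sum_apply_eq_ite, ← sub_eq_add_neg, sub_eq_zero]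
  simp [mul_comm]

theorem card_mul_eigenvalue_hadamard (o : V) (χ : AddChar Γ ℂ) (M N : Matrix V V ℂ) :
    (Fintype.card Γ : ℂ) * eigenvalue o χ (M ⊙ N) =
      ∑ τ : AddChar Γ ℂ, eigenvalue o τ M * eigenvalue o (χ - τ) N :=
  calc (Fintype.card Γ : ℂ) * eigenvalue o χ (M ⊙ N)
      = ∑ k : Γ, (Fintype.card Γ * M o (k +ᵥ o)) * (N o (k +ᵥ o) * χ k) := by
        simp only [eigenvalue_apply, hadamard_apply, Finset.mul_sum, mul_assoc]
    _ = ∑ k : Γ, ∑ τ : AddChar Γ ℂ, eigenvalue o τ M * (N o (k +ᵥ o) * (χ - τ) k) := by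
        simp only [card_mul_apply_eq_sum_eigenvalue, Finset.sum_mul, AddChar.sub_apply]
        exact Finset.sum_congr rfl fun k _ => Finset.sum_congr rfl fun τ _ => by ring
    _ = ∑ τ : AddChar Γ ℂ, eigenvalue o τ M * eigenvalue o (χ - τ) N := by
        rw [Finset.sum_comm]
        simp only [eigenvalue_apply _ _ N, Finset.mul_sum]

variable [AddAction.IsPretransitive Γ V] {M N : Matrix V V ℂ}

theorem sum_apply_vadd_mul_addChar (hM : M ∈ invariantMatrices Γ V) (o : V) (χ : AddChar Γ ℂ)
    (g : Γ) : ∑ h : Γ, M (g +ᵥ o) (h +ᵥ o) * χ h = eigenvalue o χ M * χ g := by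
  rw [eigenvalue_apply, Finset.sum_mul]
  refine Fintype.sum_equiv (Equiv.subRight g) _ _ fun h => ?_
  rw [apply_vadd_vadd_of_mem_invariantMatrices hM o, Equiv.subRight_apply, mul_assoc,
    ← AddChar.map_add_eq_mul, sub_add_cancel]

theorem mem_dualClass_iff (hM : M ∈ invariantMatrices Γ V) (o : V) (χ : AddChar Γ ℂ) :
    χ ∈ dualClass o M ↔ eigenvalue o χ M = 1 := by
  simp only [dualClass, Set.mem_ofPred_eq, finsum_eq_sum_of_fintype,
    sum_apply_vadd_mul_addChar hM]
  exact ⟨fun h => by simpa using h 0, fun h g => by rw [h, one_mul]⟩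

theorem eigenvalue_mul [Fintype V] [FaithfulVAdd Γ V] (hN : N ∈ invariantMatrices Γ V) (o : V)
    (χ : AddChar Γ ℂ) : eigenvalue o χ (M * N) = eigenvalue o χ M * eigenvalue o χ N :=
  calc eigenvalue o χ (M * N)
      = ∑ k : Γ, ∑ h : Γ, M o (h +ᵥ o) * N (h +ᵥ o) (k +ᵥ o) * χ k := by
        simp only [eigenvalue_apply, mul_apply, ← (vadd_bijective (Γ := Γ) o).sum_comp,
          Finset.sum_mul]
    _ = ∑ h : Γ, M o (h +ᵥ o) * (eigenvalue o χ N * χ h) := by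
        rw [Finset.sum_comm]
        simp only [mul_assoc, ← Finset.mul_sum, sum_apply_vadd_mul_addChar hN]
    _ = eigenvalue o χ M * eigenvalue o χ N := by
        rw [eigenvalue_apply o χ M, Finset.sum_mul]
        exact Finset.sum_congr rfl fun h _ => by ring

theorem eigenvalue_transpose (hM : M ∈ invariantMatrices Γ V) (o : V) (χ : AddChar Γ ℂ) :
    eigenvalue o χ Mᵀ = eigenvalue o (-χ) M := by
  simp only [eigenvalue_apply]
  refine Fintype.sum_equiv (Equiv.neg Γ) _ _ fun k => ?_
  have entry := apply_vadd_vadd_of_mem_invariantMatrices hM o o k 0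
  rw [zero_vadd, zero_sub] at entry
  simp [entry]

theorem eq_zero_of_eigenvalue_eq_zero (hM : M ∈ invariantMatrices Γ V) (o : V)
    (h : ∀ χ : AddChar Γ ℂ, eigenvalue o χ M = 0) : M = 0 := by
  have row_eq_zero (k : Γ) : M o (k +ᵥ o) = 0 := by
    simpa [h] using card_mul_apply_eq_sum_eigenvalue o M k
  ext u w
  obtain ⟨g, rfl⟩ := AddAction.exists_vadd_eq Γ o u
  obtain ⟨k, rfl⟩ := AddAction.exists_vadd_eq Γ o w
  rw [apply_vadd_vadd_of_mem_invariantMatrices hM o, row_eq_zero, Matrix.zero_apply]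

end Eigenvalue

theorem linearIndependent_of_orthogonalIdempotents {K R ι : Type*} [CommRing K] [IsDomain K]
    [Ring R] [Algebra K R] [Module.IsTorsionFree K R] {e : ι → R}
    (he : OrthogonalIdempotents e) (hne : ∀ i, e i ≠ 0) : LinearIndependent K e := by
  classical
  refine linearIndependent_iff'.2 fun s c hc j hj => ?_
  have mul_right : (∑ i ∈ s, c i • e i) * e j = c j • e j := by
    simp [Finset.sum_mul, he.mul_eq, hj]
  rw [hc, zero_mul] at mul_right
  exact (smul_eq_zero.1 mul_right.symm).resolve_right (hne j)

section BoseMesner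

variable {V : Type*} [Fintype V] {d : ℕ} {A E : Fin (d + 1) → Matrix V V ℂ}

theorem IsPrincipalIdempotents.span_eq (hE : IsPrincipalIdempotents A E) :
    Submodule.span ℂ (Set.range E) = boseMesner A := by
  classical
  have orthogonal : OrthogonalIdempotents E := ⟨hE.mul_self, hE.mul_of_ne⟩
  refine Submodule.eq_of_le_of_finrank_le
    (Submodule.span_le.2 (Set.range_subset_iff.2 hE.mem)) ?_
  rw [finrank_span_eq_card (linearIndependent_of_orthogonalIdempotents orthogonal hE.ne_zero)]
  exact finrank_range_le_card A

theorem IsPrincipalIdempotents.exists_sum_smul_eq (hE : IsPrincipalIdempotents A E)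
    {M : Matrix V V ℂ} (hM : M ∈ boseMesner A) :
    ∃ a : Fin (d + 1) → ℂ, ∑ j, a j • E j = M := by
  rwa [← hE.span_eq, Submodule.mem_span_range_iff_exists_fun] at hM

theorem IsAssociationScheme.transpose_mem_boseMesner (hA : IsAssociationScheme A)
    {M : Matrix V V ℂ} (hM : M ∈ boseMesner A) : Mᵀ ∈ boseMesner A := by
  suffices boseMesner A ≤ (boseMesner A).comap (transposeLinearEquiv V V ℂ ℂ).toLinearMap from
    this hM
  refine Submodule.span_le.2 (Set.range_subset_iff.2 fun i => ?_)
  obtain ⟨j, hj⟩ := hA.transpose_mem i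
  exact Submodule.subset_span ⟨j, hj.symm⟩

theorem IsAssociationScheme.eq_of_apply_eq_one (hA : IsAssociationScheme A) {i j : Fin (d + 1)}
    {u w : V} (hi : A i u w = 1) (hj : A j u w = 1) : i = j := by
  classical
  have entry (r : Fin (d + 1)) : A r u w = if A r u w = 1 then 1 else 0 := by
    rcases hA.zero_or_one r u w with h | h <;> simp [h]
  have card_eq_one : Finset.card {r | A r u w = 1} = 1 := by
    have sum_eq_one : ∑ r, A r u w = 1 := by
      simpa [Matrix.sum_apply] using congrFun₂ hA.sum_eq u w
    rw [Finset.sum_congr rfl fun r _ => entry r, Finset.sum_boole] at sum_eq_one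
    exact_mod_cast sum_eq_one
  exact Finset.card_le_one.1 card_eq_one.le i (by simpa using hi) j (by simpa using hj)

theorem IsAssociationScheme.hadamard_eq (hA : IsAssociationScheme A) (i j : Fin (d + 1)) :
    A i ⊙ A j = if i = j then A i else 0 := by
  ext u w
  split_ifs with hij
  · subst hij
    rcases hA.zero_or_one i u w with h | h <;> simp [h]
  · rcases hA.zero_or_one i u w with hi | hi
    · simp [hi]
    · have hj := (hA.zero_or_one j u w).resolve_right fun hj => hij (hA.eq_of_apply_eq_one hi hj)
      simp [hj]

theorem IsAssociationScheme.hadamard_mem_boseMesner (hA : IsAssociationScheme A)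
    {M N : Matrix V V ℂ} (hM : M ∈ boseMesner A) (hN : N ∈ boseMesner A) :
    M ⊙ N ∈ boseMesner A := by
  induction hM, hN using Submodule.span_induction₂ with
  | mem_mem M N hM hN =>
    obtain ⟨⟨i, rfl⟩, j, rfl⟩ := hM, hN
    rw [hA.hadamard_eq]
    split_ifs
    exacts [Submodule.subset_span ⟨i, rfl⟩, zero_mem _]
  | zero_left | zero_right => simp
  | add_left _ _ _ _ _ _ h₁ h₂ => simpa only [add_hadamard] using add_mem h₁ h₂
  | add_right _ _ _ _ _ _ h₁ h₂ => simpa only [hadamard_add] using add_mem h₁ h₂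
  | smul_left a _ _ _ _ h => simpa only [smul_hadamard] using Submodule.smul_mem _ a h
  | smul_right a _ _ _ _ h => simpa only [hadamard_smul] using Submodule.smul_mem _ a h

theorem IsAssociationScheme.injective_of_apply_eq {W : Type*} {f : V → W}
    {B : Matrix W W ℂ} (hA : IsAssociationScheme A) (h : ∀ u w, A 0 u w = B (f u) (f w)) :
    Function.Injective f := by
  classical
  intro u w huw
  have entry : A 0 u w = A 0 w w := by rw [h, h, huw]
  by_contra hne
  simp [hA.zero_eq_one, hne] at entry

theorem IsPrincipalIdempotents.mem_invariantMatrices {Γ : Type*} [AddCommGroup Γ]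
    [AddAction Γ V] (hE : IsPrincipalIdempotents A E) (hΓ : ActsByAutomorphisms Γ A)
    (j : Fin (d + 1)) : E j ∈ invariantMatrices Γ V :=
  hΓ.boseMesner_le (hE.mem j)

end BoseMesner

section DifferenceScheme

variable {G : Type*} [AddCommGroup G] {d : ℕ}

/-- The relations `{(x, y) | c (x - y) = j}` on an abelian group, as `01`-matrices: the candidate
translation scheme whose classes are the fibres of `c`. -/
def differenceScheme (c : G → Fin (d + 1)) : Fin (d + 1) → Matrix G G ℂ :=
  fun j => Matrix.of fun x y => if c (x - y) = j then 1 else 0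

theorem differenceScheme_apply (c : G → Fin (d + 1)) (j : Fin (d + 1)) (x y : G) :
    differenceScheme c j x y = if c (x - y) = j then 1 else 0 := rfl

variable [Fintype G]

/-- The number of ways to write `x` as a sum of an element of the fibre of `c` over `i` and one of
the fibre over `j`. -/
def convolutionCount (c : G → Fin (d + 1)) (i j : Fin (d + 1)) (x : G) : ℕ :=
  Finset.card {z | c z = i ∧ c (x - z) = j}

theorem convolutionCount_comm (c : G → Fin (d + 1)) (i j : Fin (d + 1)) (x : G) :
    convolutionCount c i j x = convolutionCount c j i x :=
  Finset.card_equiv (Equiv.subLeft x) fun z => by simp [and_comm]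

theorem natCast_convolutionCount (c : G → Fin (d + 1)) (i j : Fin (d + 1)) (x : G) :
    (convolutionCount c i j x : ℂ) =
      ∑ z, (if c z = i then 1 else 0) * (if c (x - z) = j then 1 else 0) := by
  simp only [convolutionCount, Finset.natCast_card_filter, ite_and, ite_mul, one_mul, zero_mul]

theorem differenceScheme_mul_apply (c : G → Fin (d + 1)) (i j : Fin (d + 1)) (x y : G) :
    (differenceScheme c i * differenceScheme c j) x y = convolutionCount c i j (x - y) := by
  rw [natCast_convolutionCount, mul_apply]
  refine Fintype.sum_equiv (Equiv.subLeft x) _ _ fun z => ?_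
  simp only [differenceScheme_apply, Equiv.subLeft_apply, sub_right_comm x y,
    sub_sub_cancel]

/-- The fibres of `c` are the basic sets of a Schur ring over the abelian group `G`: they are
nonempty, `{0}` is the fibre over `0`, and they are permuted by negation and closed under
convolution. This is what makes `differenceScheme c` an association scheme. -/
structure IsSchurPartition (c : G → Fin (d + 1)) : Prop where
  surjective : Function.Surjective c
  eq_zero_iff : ∀ x, c x = 0 ↔ x = 0
  neg_congr : ∀ x y, c x = c y → c (-x) = c (-y)
  convolutionCount_congr : ∀ i j x y, c x = c y →
    convolutionCount c i j x = convolutionCount c i j y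

theorem IsSchurPartition.exists_transpose_eq {c : G → Fin (d + 1)} (hc : IsSchurPartition c)
    (i : Fin (d + 1)) : ∃ j, (differenceScheme c i)ᵀ = differenceScheme c j := by
  obtain ⟨x, rfl⟩ := hc.surjective i
  refine ⟨c (-x), ?_⟩
  ext y z
  refine if_congr ⟨fun h => ?_, fun h => ?_⟩ rfl rfl
  · simpa using hc.neg_congr _ _ h
  · simpa using hc.neg_congr _ _ h

theorem IsSchurPartition.mul_eq_sum {c : G → Fin (d + 1)} (hc : IsSchurPartition c)
    (i j : Fin (d + 1)) :
    differenceScheme c i * differenceScheme c j =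
      ∑ r, (convolutionCount c i j (Function.surjInv hc.surjective r) : ℂ) •
        differenceScheme c r := by
  ext x y
  rw [differenceScheme_mul_apply, hc.convolutionCount_congr i j (x - y) _
    (Function.surjInv_eq hc.surjective (c (x - y))).symm]
  simp [Matrix.sum_apply, differenceScheme_apply]

theorem IsSchurPartition.isAssociationScheme {c : G → Fin (d + 1)} (hc : IsSchurPartition c) :
    IsAssociationScheme (differenceScheme c) where
  zero_or_one i x y := by rw [differenceScheme_apply]; split_ifs <;> simp
  ne_zero i h := by
    obtain ⟨x, rfl⟩ := hc.surjective i
    simpa [differenceScheme_apply] using congrFun₂ h x 0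
  zero_eq_one := by
    classical
    ext x y
    rw [differenceScheme_apply, one_apply]
    exact if_congr ((hc.eq_zero_iff _).trans sub_eq_zero) rfl rfl
  sum_eq := by
    ext x y
    simp [Matrix.sum_apply, differenceScheme_apply]
  transpose_mem := hc.exists_transpose_eq
  mul_eq := ⟨_, hc.mul_eq_sum⟩
  mul_comm i j := by
    ext x y
    rw [differenceScheme_mul_apply, differenceScheme_mul_apply, convolutionCount_comm]

end DifferenceScheme

section DualIndex

variable {Γ V : Type*} [AddCommGroup Γ] [Fintype Γ] [AddAction Γ V] {d : ℕ}
  {A E : Fin (d + 1) → Matrix V V ℂ} {o : V} {c : AddChar Γ ℂ → Fin (d + 1)}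

/-- `c χ` is the index of the idempotent whose column space contains the character `χ`, regarded
as a function on `V`; so the fibres of `c` are the classes of the dual scheme. -/
def IsDualIndex (o : V) (E : Fin (d + 1) → Matrix V V ℂ) (c : AddChar Γ ℂ → Fin (d + 1)) : Prop :=
  ∀ j χ, eigenvalue o χ (E j) = if c χ = j then 1 else 0

theorem IsDualIndex.eigenvalue_sum_smul (hc : IsDualIndex o E c) (a : Fin (d + 1) → ℂ)
    (χ : AddChar Γ ℂ) : eigenvalue o χ (∑ j, a j • E j) = a (c χ) := by
  simp [hc _ χ]

theorem IsDualIndex.convolutionCount_congr [Fintype V] (hc : IsDualIndex o E c)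
    (hA : IsAssociationScheme A) (hE : IsPrincipalIdempotents A E) (i j : Fin (d + 1))
    {χ ψ : AddChar Γ ℂ} (h : c χ = c ψ) : convolutionCount c i j χ = convolutionCount c i j ψ := by
  obtain ⟨a, ha⟩ := hE.exists_sum_smul_eq (hA.hadamard_mem_boseMesner (hE.mem i) (hE.mem j))
  have count_eq (τ : AddChar Γ ℂ) : (convolutionCount c i j τ : ℂ) = Fintype.card Γ * a (c τ) := by
    rw [← hc.eigenvalue_sum_smul a τ, ha, card_mul_eigenvalue_hadamard, natCast_convolutionCount]
    simp only [hc _ _]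
  exact_mod_cast (count_eq χ).trans (h ▸ (count_eq ψ).symm)

variable [AddAction.IsPretransitive Γ V]

theorem IsDualIndex.dualScheme_eq (hc : IsDualIndex o E c)
    (hinv : ∀ j, E j ∈ invariantMatrices Γ V) : dualScheme Γ o E = differenceScheme c := by
  funext j
  ext χ ψ
  have mem_iff : χ * ψ⁻¹ ∈ dualClass o (E j) ↔ c (χ - ψ) = j := by
    rw [show χ * ψ⁻¹ = χ - ψ from (sub_eq_add_neg χ ψ).symm, mem_dualClass_iff (hinv j), hc]
    simp
  simp only [dualScheme, of_apply, differenceScheme_apply, mem_iff]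

theorem IsDualIndex.surjective (hc : IsDualIndex o E c)
    (hinv : ∀ j, E j ∈ invariantMatrices Γ V) (hne : ∀ j, E j ≠ 0) : Function.Surjective c := by
  intro j
  by_contra! h
  exact hne j (eq_zero_of_eigenvalue_eq_zero (hinv j) o fun χ => by rw [hc, if_neg (h χ)])

variable [Fintype V]

theorem IsDualIndex.neg_congr (hc : IsDualIndex o E c) (hA : IsAssociationScheme A)
    (hE : IsPrincipalIdempotents A E) (hΓ : ActsByAutomorphisms Γ A) {χ ψ : AddChar Γ ℂ}
    (h : c χ = c ψ) : c (-χ) = c (-ψ) := by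
  obtain ⟨a, ha⟩ := hE.exists_sum_smul_eq (hA.transpose_mem_boseMesner (hE.mem (c (-ψ))))
  have indicator_neg (τ : AddChar Γ ℂ) : (if c (-τ) = c (-ψ) then (1 : ℂ) else 0) = a (c τ) := by
    rw [← hc, ← eigenvalue_transpose (hE.mem_invariantMatrices hΓ _), ← ha,
      hc.eigenvalue_sum_smul]
  have indicator_eq_one := (indicator_neg χ).trans (h ▸ (indicator_neg ψ).symm)
  by_contra hne
  simp [hne] at indicator_eq_one

variable [FaithfulVAdd Γ V]

theorem IsPrincipalIdempotents.exists_isDualIndex (hE : IsPrincipalIdempotents A E)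
    (hΓ : ActsByAutomorphisms Γ A) (o : V) :
    ∃ c : AddChar Γ ℂ → Fin (d + 1), IsDualIndex o E c := by
  classical
  have hinv := hE.mem_invariantMatrices hΓ
  suffices ∀ χ : AddChar Γ ℂ, ∃ i, ∀ j, eigenvalue o χ (E j) = if i = j then 1 else 0 by
    choose c hc using this
    exact ⟨c, fun j χ => hc χ j⟩
  intro χ
  have sum_eq_one : ∑ j, eigenvalue o χ (E j) = 1 := by
    rw [← map_sum, hE.sum_eq, eigenvalue_one]
  obtain ⟨i, -, hi⟩ := Finset.exists_ne_zero_of_sum_ne_zero (sum_eq_one.trans_ne one_ne_zero)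
  have eigenvalue_mul_idempotent (j : Fin (d + 1)) := eigenvalue_mul (M := E i) (hinv j) o χ
  refine ⟨i, fun j => ?_⟩
  split_ifs with hij
  · subst hij
    exact (mul_eq_left₀ hi).1 (by rw [← eigenvalue_mul_idempotent, hE.mul_self])
  · refine (mul_eq_zero.1 ?_).resolve_left hi
    rw [← eigenvalue_mul_idempotent, hE.mul_of_ne i j hij, map_zero]

theorem IsDualIndex.eq_zero_iff (hc : IsDualIndex o E c) (hE : IsPrincipalIdempotents A E)
    (χ : AddChar Γ ℂ) : c χ = 0 ↔ χ = 0 := by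
  have card_ne_zero : (Fintype.card Γ : ℂ) ≠ 0 := Nat.cast_ne_zero.2 Fintype.card_ne_zero
  have indicator_eq : (if c χ = 0 then (1 : ℂ) else 0) = if χ = 0 then 1 else 0 := by
    rw [← hc 0 χ, eigenvalue_apply]
    simp only [hE.zero_eq, of_apply, ← Finset.mul_sum, AddChar.sum_eq_ite,
      card_eq_card_of_regular (Γ := Γ) o]
    split_ifs <;> simp [card_ne_zero]
  by_cases hχ : χ = 0 <;> simpa [hχ] using indicator_eq

theorem IsDualIndex.isSchurPartition (hc : IsDualIndex o E c) (hA : IsAssociationScheme A)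
    (hE : IsPrincipalIdempotents A E) (hΓ : ActsByAutomorphisms Γ A) : IsSchurPartition c where
  surjective := hc.surjective (hE.mem_invariantMatrices hΓ) hE.ne_zero
  eq_zero_iff := hc.eq_zero_iff hE
  neg_congr _ _ := hc.neg_congr hA hE hΓ
  convolutionCount_congr i j _ _ := hc.convolutionCount_congr hA hE i j

end DualIndex

section WeightEnumerator

open MvPolynomial (X)

variable {V : Type*} {d n : ℕ}

theorem charVec_dotProduct_mulVec {W : Type*} [Fintype W] (C : Set W) [Fintype C]
    (M : Matrix W W ℂ) : charVec C ⬝ᵥ (M *ᵥ charVec C) = ∑ u : C, ∑ w : C, M u w := by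
  classical
  have sum_charVec_mul (f : W → ℂ) : ∑ u, charVec C u * f u = ∑ u : C, f u := by
    simp only [charVec, Set.indicator_apply, ite_mul, one_mul, zero_mul]
    rw [← Finset.sum_filter]
    exact Finset.sum_subtype _ (by simp) f
  simp only [dotProduct, mulVec, mul_comm (M _ _), sum_charVec_mul]

theorem sum_C_charVec_dotProduct_mulVec_mul {W ι σ : Type*} [Fintype W] (C : Set W) [Fintype C]
    (s : Finset ι) (M : ι → Matrix W W ℂ) (t : ι → MvPolynomial σ ℂ) :
    ∑ α ∈ s, MvPolynomial.C (charVec C ⬝ᵥ (M α *ᵥ charVec C)) * t α =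
      ∑ u : C, ∑ w : C, ∑ α ∈ s, MvPolynomial.C (M α u w) * t α := by
  simp only [charVec_dotProduct_mulVec, map_sum, Finset.sum_mul]
  rw [Finset.sum_comm]
  exact Finset.sum_congr rfl fun u _ => Finset.sum_comm

/-- The vector whose `r`-th entry is the number of occurrences of `r` in the word `i`: the
exponent vector of the monomial `∏ k, X (i k)`. -/
def valueCount (i : Fin n → Fin (d + 1)) : Fin (d + 1) → ℕ :=
  fun r => Finset.card {k | i k = r}

theorem valueCount_mem_piAntidiag (i : Fin n → Fin (d + 1)) :
    valueCount i ∈ Finset.piAntidiag Finset.univ n := by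
  have sum_eq : ∑ r, valueCount i r = Fintype.card (Fin n) :=
    (Finset.card_eq_sum_card_fiberwise fun k _ => Finset.mem_coe.2 (Finset.mem_univ (i k))).symm
  simpa using sum_eq

theorem prod_X_pow_valueCount (i : Fin n → Fin (d + 1)) :
    ∏ r, (X r : MvPolynomial (Fin (d + 1)) ℂ) ^ valueCount i r = ∏ k, X (i k) := by
  rw [← Finset.prod_fiberwise' Finset.univ i]
  simp [valueCount]

theorem sum_C_hammingIdempotent_mul_prod_X_pow (E : Fin (d + 1) → Matrix V V ℂ)
    (u w : Fin n → V) :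
    ∑ β ∈ Finset.piAntidiag Finset.univ n,
        MvPolynomial.C (hammingIdempotent n E β u w) * ∏ r, X r ^ β r =
      ∏ k, ∑ r, MvPolynomial.C (E r (u k) (w k)) * X r := by
  classical
  have term (β : Fin (d + 1) → ℕ) :
      MvPolynomial.C (hammingIdempotent n E β u w) * ∏ r, X r ^ β r =
        ∑ i with valueCount i = β, ∏ k, MvPolynomial.C (E (i k) (u k) (w k)) * X (i k) := by
    rw [hammingIdempotent, Matrix.sum_apply, map_sum, Finset.sum_mul]
    refine Finset.sum_congr (by ext; simp [valueCount, funext_iff]) fun i hi => ?_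
    obtain rfl : valueCount i = β := by simpa using hi
    rw [prod_X_pow_valueCount, of_apply, map_prod, Finset.prod_mul_distrib]
  simp only [term]
  rw [Finset.sum_fiberwise_of_maps_to fun i _ => valueCount_mem_piAntidiag i, Fintype.prod_sum]

theorem dualWeightEnumerator_eq_sum_prod [Fintype V] (E : Fin (d + 1) → Matrix V V ℂ)
    (C : Set (Fin n → V)) [Fintype C] :
    dualWeightEnumerator E C =
      MvPolynomial.C ((Fintype.card V : ℂ) ^ n / (C.ncard : ℂ) ^ 2) *
        ∑ u : C, ∑ w : C, ∏ k, ∑ r, MvPolynomial.C (E r (u.1 k) (w.1 k)) * X r := by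
  rw [dualWeightEnumerator, sum_C_charVec_dotProduct_mulVec_mul]
  simp only [sum_C_hammingIdempotent_mul_prod_X_pow]

theorem charVec_image_dotProduct_mulVec {U W : Type*} [Fintype U] [Fintype W] {f : W → U}
    (hf : Function.Injective f) (D : Set W) (M : Matrix U U ℂ) :
    charVec (f '' D) ⬝ᵥ (M *ᵥ charVec (f '' D)) = charVec D ⬝ᵥ (M.submatrix f f *ᵥ charVec D) := by
  classical
  have sum_image (F : U → ℂ) : ∑ u : ↥(f '' D), F u = ∑ x : D, F (f x) :=
    ((Equiv.Set.image f D hf).sum_comp fun u => F u).symm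
  simp only [charVec_dotProduct_mulVec, submatrix_apply]
  rw [sum_image fun u => ∑ w : ↥(f '' D), M u w]
  exact Finset.sum_congr rfl fun x _ => sum_image (M (f x))

theorem weightEnumerator_image {W : Type*} [Fintype V] [Fintype W]
    {A : Fin (d + 1) → Matrix V V ℂ} {B : Fin (d + 1) → Matrix W W ℂ} {f : Fin n → W → V}
    (hf : ∀ k, Function.Injective (f k)) (h : ∀ k r x y, A r (f k x) (f k y) = B r x y)
    (D : Set (Fin n → W)) : weightEnumerator A (Pi.map f '' D) = weightEnumerator B D := by
  have injective : Function.Injective (Pi.map f) := Function.Injective.piMap hf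
  have relCount_map (x y : Fin n → W) :
      relCount A (Pi.map f x) (Pi.map f y) = relCount B x y := by
    funext r
    simp only [relCount, Pi.map_apply, h]
  have submatrix_eq (α : Fin (d + 1) → ℕ) :
      (hammingMatrix n A α).submatrix (Pi.map f) (Pi.map f) = hammingMatrix n B α := by
    ext x y
    simp [hammingMatrix, relCount_map]
  simp only [weightEnumerator, Set.ncard_image_of_injective D injective,
    charVec_image_dotProduct_mulVec injective, submatrix_eq]

theorem sum_sum_sub {G M : Type*} [AddGroup G] [Fintype G] [AddCommMonoid M] (f : G → M) :
    ∑ x, ∑ y, f (x - y) = Fintype.card G • ∑ x, f x := by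
  rw [Finset.sum_comm, ← Finset.card_univ, ← Finset.sum_const]
  exact Finset.sum_congr rfl fun y _ => (Equiv.subRight y).sum_comp f

theorem weightEnumerator_differenceScheme {G : Type*} [AddCommGroup G] [Fintype G]
    (c : G → Fin (d + 1)) (S : AddSubgroup (Fin n → G)) [Fintype S] :
    weightEnumerator (differenceScheme c) (S : Set (Fin n → G)) =
      ∑ x : S, ∏ k, X (c (x.1 k)) := by
  have relCount_eq (x y : Fin n → G) :
      relCount (differenceScheme c) x y = valueCount fun k => c ((x - y) k) := by
    funext r
    simp [relCount, valueCount, differenceScheme_apply]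
  have pair_term (x y : Fin n → G) :
      ∑ α ∈ Finset.piAntidiag Finset.univ n,
        MvPolynomial.C (hammingMatrix n (differenceScheme c) α x y) * ∏ r, X r ^ α r =
      ∏ k, X (c ((x - y) k)) := by
    simp only [hammingMatrix, of_apply, relCount_eq, apply_ite MvPolynomial.C, map_one, map_zero,
      ite_mul, one_mul, zero_mul, Finset.sum_ite_eq, valueCount_mem_piAntidiag, if_true,
      prod_X_pow_valueCount]
  have card_ne_zero : (Fintype.card S : ℂ) ≠ 0 := Nat.cast_ne_zero.2 Fintype.card_ne_zero
  have ncard_eq : (S : Set (Fin n → G)).ncard = Fintype.card S := by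
    rw [← Nat.card_eq_fintype_card]
    rfl
  rw [weightEnumerator, sum_C_charVec_dotProduct_mulVec_mul]
  simp only [pair_term]
  refine (congrArg _ (sum_sum_sub fun x : S => ∏ k, X (c (x.1 k)))).trans ?_
  rw [ncard_eq, nsmul_eq_mul, ← map_natCast MvPolynomial.C, ← mul_assoc, ← map_mul,
    one_div_mul_cancel card_ne_zero, map_one, one_mul]

end WeightEnumerator

section Duality

open MvPolynomial (X)

variable {Γ V : Type*} [AddCommGroup Γ] [AddAction Γ V] {d n : ℕ}

/-- The character `g ↦ ∏ k, χ k (g k)` of `Γ ^ n` with components `χ k`. -/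
def tupleChar (χ : Fin n → AddChar Γ ℂ) : AddChar (Fin n → Γ) ℂ where
  toFun g := ∏ k, χ k (g k)
  map_zero_eq_one' := by simp
  map_add_eq_mul' g h := by simp [AddChar.map_add_eq_mul, Finset.prod_mul_distrib]

theorem tupleChar_apply (χ : Fin n → AddChar Γ ℂ) (g : Fin n → Γ) :
    tupleChar χ g = ∏ k, χ k (g k) := rfl

/-- The dual `dualSet Γ b C`, as a subgroup of the group of tuples of characters. -/
def dualSubgroup (Γ : Type*) {V : Type*} [AddCommGroup Γ] [AddAction Γ V] {n : ℕ} (b : Fin n → V)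
    (C : Set (Fin n → V)) : AddSubgroup (Fin n → AddChar Γ ℂ) where
  carrier := dualSet Γ b C
  add_mem' hχ hψ g hg := by
    simp only [Pi.add_apply, AddChar.add_apply, Finset.prod_mul_distrib, hχ g hg, hψ g hg, mul_one]
  zero_mem' _ _ := by simp
  neg_mem' hχ g hg := by
    simp only [Pi.neg_apply, AddChar.neg_apply', Finset.prod_inv_distrib, hχ g hg, inv_one]

theorem sum_sum_addChar_sub_eq_ite {G : Type*} [AddCommGroup G] [Fintype G] (ψ : AddChar G ℂ)
    [Decidable (ψ = 0)] :
    ∑ x, ∑ y, ψ (x - y) = if ψ = 0 then (Fintype.card G : ℂ) ^ 2 else 0 := by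
  rw [sum_sum_sub, AddChar.sum_eq_ite]
  split_ifs <;> simp [sq]

variable {b : Fin n → V} {C : Set (Fin n → V)} {H : AddSubgroup (Fin n → Γ)}

theorem exists_equiv_of_mem_iff_vadd_mem [FaithfulVAdd Γ V] [AddAction.IsPretransitive Γ V]
    (hH : ∀ g : Fin n → Γ, g ∈ H ↔ (fun k => g k +ᵥ b k) ∈ C) :
    ∃ e : H ≃ C, ∀ (g : H) k, (e g).1 k = g.1 k +ᵥ b k :=
  ⟨(Equiv.ofBijective _ (Function.Bijective.piMap fun k => vadd_bijective (b k))).subtypeEquiv hH,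
    fun _ _ => rfl⟩

theorem sum_sum_tupleChar_sub_eq_ite [Fintype H]
    (hH : ∀ g : Fin n → Γ, g ∈ H ↔ (fun k => g k +ᵥ b k) ∈ C) (χ : Fin n → AddChar Γ ℂ)
    [Decidable (χ ∈ dualSubgroup Γ b C)] :
    ∑ g : H, ∑ h : H, tupleChar χ (g.1 - h.1) =
      if χ ∈ dualSubgroup Γ b C then (Fintype.card H : ℂ) ^ 2 else 0 := by
  classical
  have restrict_eq_zero_iff :
      (tupleChar χ).compAddMonoidHom H.subtype = 0 ↔ χ ∈ dualSubgroup Γ b C := by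
    refine AddChar.eq_zero_iff.trans ⟨fun h g hg => h ⟨g, (hH g).2 hg⟩, fun h g => ?_⟩
    exact h g.1 ((hH g.1).1 g.2)
  simp only [← restrict_eq_zero_iff, ← sum_sum_addChar_sub_eq_ite]
  rfl

theorem sum_sum_sum_C_tupleChar_sub_mul {σ : Type*} [Finite Γ] [Fintype H]
    [Fintype (dualSubgroup Γ b C)]
    (hH : ∀ g : Fin n → Γ, g ∈ H ↔ (fun k => g k +ᵥ b k) ∈ C)
    (t : (Fin n → AddChar Γ ℂ) → MvPolynomial σ ℂ) :
    ∑ g : H, ∑ h : H, ∑ χ, MvPolynomial.C (tupleChar χ (g.1 - h.1)) * t χ =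
      MvPolynomial.C ((Fintype.card H : ℂ) ^ 2) * ∑ χ : dualSubgroup Γ b C, t χ := by
  classical
  calc ∑ g : H, ∑ h : H, ∑ χ, MvPolynomial.C (tupleChar χ (g.1 - h.1)) * t χ
      = ∑ χ, MvPolynomial.C (∑ g : H, ∑ h : H, tupleChar χ (g.1 - h.1)) * t χ := by
        simp only [map_sum, Finset.sum_mul]
        exact (Finset.sum_congr rfl fun _ _ => Finset.sum_comm).trans Finset.sum_comm
    _ = MvPolynomial.C ((Fintype.card H : ℂ) ^ 2) * ∑ χ with χ ∈ dualSubgroup Γ b C, t χ := by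
        simp only [sum_sum_tupleChar_sub_eq_ite hH, apply_ite MvPolynomial.C, map_zero, ite_mul,
          zero_mul, ← Finset.sum_filter, ← Finset.mul_sum]
    _ = MvPolynomial.C ((Fintype.card H : ℂ) ^ 2) * ∑ χ : dualSubgroup Γ b C, t χ :=
        congrArg _ (Finset.sum_subtype _ (by simp) t)

variable [Fintype Γ] {E : Fin (d + 1) → Matrix V V ℂ} {o : V} {c : AddChar Γ ℂ → Fin (d + 1)}

theorem IsDualIndex.C_card_mul_sum_C_mul_X [AddAction.IsPretransitive Γ V]
    (hc : IsDualIndex o E c) (hinv : ∀ j, E j ∈ invariantMatrices Γ V) (b : V) (g h : Γ) :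
    MvPolynomial.C (Fintype.card Γ : ℂ) *
        ∑ r, MvPolynomial.C (E r (g +ᵥ b) (h +ᵥ b)) * X r =
      ∑ χ : AddChar Γ ℂ, MvPolynomial.C (χ (g - h)) * X (c χ) := by
  have entry (r : Fin (d + 1)) :
      (Fintype.card Γ : ℂ) * E r (g +ᵥ b) (h +ᵥ b) =
        ∑ χ : AddChar Γ ℂ, if c χ = r then χ (g - h) else 0 := by
    rw [apply_vadd_vadd_of_mem_invariantMatrices (hinv r) o, card_mul_apply_eq_sum_eigenvalue,
      neg_sub]
    simp only [hc r _, ite_mul, one_mul, zero_mul]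
  simp only [Finset.mul_sum, ← mul_assoc, ← map_mul, entry, map_sum, Finset.sum_mul]
  rw [Finset.sum_comm]
  simp [apply_ite MvPolynomial.C]

theorem IsDualIndex.C_card_pow_mul_prod_sum_C_mul_X [AddAction.IsPretransitive Γ V]
    (hc : IsDualIndex o E c) (hinv : ∀ j, E j ∈ invariantMatrices Γ V) (g h : Fin n → Γ) :
    MvPolynomial.C ((Fintype.card Γ : ℂ) ^ n) *
        ∏ k, ∑ r, MvPolynomial.C (E r (g k +ᵥ b k) (h k +ᵥ b k)) * X r =
      ∑ χ : Fin n → AddChar Γ ℂ, MvPolynomial.C (tupleChar χ (g - h)) * ∏ k, X (c (χ k)) := by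
  have const_eq_prod : (MvPolynomial.C ((Fintype.card Γ : ℂ) ^ n) : MvPolynomial (Fin (d + 1)) ℂ) =
      ∏ _k : Fin n, MvPolynomial.C (Fintype.card Γ : ℂ) := by
    simp
  rw [const_eq_prod, ← Finset.prod_mul_distrib]
  simp only [hc.C_card_mul_sum_C_mul_X hinv, Fintype.prod_sum, Finset.prod_mul_distrib,
    tupleChar_apply, map_prod, Pi.sub_apply]

variable [FaithfulVAdd Γ V] [AddAction.IsPretransitive Γ V]

theorem IsDualIndex.dualWeightEnumerator_eq_sum_dualSubgroup [Fintype V]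
    [Fintype (dualSubgroup Γ b C)] (hc : IsDualIndex o E c)
    (hinv : ∀ j, E j ∈ invariantMatrices Γ V) (hC : IsAdditive Γ b C) :
    dualWeightEnumerator E C = ∑ χ : dualSubgroup Γ b C, ∏ k, X (c (χ.1 k)) := by
  classical
  obtain ⟨H, hH⟩ := hC
  obtain ⟨e, he⟩ := exists_equiv_of_mem_iff_vadd_mem hH
  have card_ne_zero : (Fintype.card H : ℂ) ^ 2 ≠ 0 :=
    pow_ne_zero 2 (Nat.cast_ne_zero.2 Fintype.card_ne_zero)
  have ncard_eq : C.ncard = Fintype.card H := by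
    rw [← Nat.card_coe_set_eq, ← Nat.card_eq_fintype_card, Nat.card_congr e]
  have orthogonality :
      MvPolynomial.C ((Fintype.card Γ : ℂ) ^ n) *
          ∑ g : H, ∑ h : H, ∏ k, ∑ r, MvPolynomial.C (E r (g.1 k +ᵥ b k) (h.1 k +ᵥ b k)) * X r =
        MvPolynomial.C ((Fintype.card H : ℂ) ^ 2) *
          ∑ χ : dualSubgroup Γ b C, ∏ k, X (c (χ.1 k)) := by
    rw [← sum_sum_sum_C_tupleChar_sub_mul hH fun χ => ∏ k, X (c (χ k))]
    simp only [Finset.mul_sum, hc.C_card_pow_mul_prod_sum_C_mul_X hinv]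
  rw [dualWeightEnumerator_eq_sum_prod, ← e.sum_comp]
  simp only [← e.sum_comp, he]
  rw [ncard_eq, card_eq_card_of_regular (Γ := Γ) o, div_eq_inv_mul, map_mul, mul_assoc,
    orthogonality, ← mul_assoc, ← map_mul, inv_mul_cancel₀ card_ne_zero, map_one, one_mul]

theorem IsDualIndex.weightEnumerator_dualSet [Fintype V] (hc : IsDualIndex o E c)
    (hinv : ∀ j, E j ∈ invariantMatrices Γ V) (hC : IsAdditive Γ b C) :
    weightEnumerator (dualScheme Γ o E) (dualSet Γ b C) = dualWeightEnumerator E C := by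
  classical
  rw [hc.dualScheme_eq hinv, hc.dualWeightEnumerator_eq_sum_dualSubgroup hinv hC]
  exact weightEnumerator_differenceScheme c (dualSubgroup Γ b C)

end Duality

end TranslationDuality

open TranslationDuality in
theorem mainTheorem8_general {V Γ : Type*} [Fintype V] [AddCommGroup Γ] [Finite Γ] [AddAction Γ V]
    [FaithfulVAdd Γ V] [AddAction.IsPretransitive Γ V] {d : ℕ}
    (A E : Fin (d + 1) → Matrix V V ℂ)
    (hA : IsAssociationScheme A) (hE : IsPrincipalIdempotents A E)
    (hΓ : ActsByAutomorphisms Γ A) (o : V) :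
    IsAssociationScheme (dualScheme Γ o E) ∧
    ∀ (n : ℕ) (b : Fin n → V) (C : Set (Fin n → V)), IsAdditive Γ b C →
      weightEnumerator (dualScheme Γ o E) (dualSet Γ b C) = dualWeightEnumerator E C ∧
      ∀ f : Fin n → AddChar Γ ℂ → V,
        (∀ k j χ ψ, dualScheme Γ o E j χ ψ = A j (f k χ) (f k ψ)) →
        weightEnumerator A (Pi.map f '' dualSet Γ b C) = dualWeightEnumerator E C := by
  have := Fintype.ofFinite Γ
  have hinv := hE.mem_invariantMatrices hΓ
  obtain ⟨c, hc⟩ := hE.exists_isDualIndex hΓ o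
  have hdual : IsAssociationScheme (dualScheme Γ o E) :=
    hc.dualScheme_eq hinv ▸ (hc.isSchurPartition hA hE hΓ).isAssociationScheme
  refine ⟨hdual, fun n b C hC => ?_⟩
  have duality := hc.weightEnumerator_dualSet hinv hC
  refine ⟨duality, fun f hf => ?_⟩
  rw [← duality]
  exact weightEnumerator_image (fun k => hdual.injective_of_apply_eq (hf k 0))
    (fun k j χ ψ => (hf k j χ ψ).symm) _

theorem mainTheorem8 {V Γ : Type*} [Fintype V] [AddCommGroup Γ] [Finite Γ] [AddAction Γ V]
    [FaithfulVAdd Γ V] [AddAction.IsPretransitive Γ V] {d : ℕ}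
    (A E : Fin (d + 1) → Matrix V V ℂ)
    (hA : TranslationDuality.IsAssociationScheme A)
    (hE : TranslationDuality.IsPrincipalIdempotents A E)
    (hΓ : TranslationDuality.ActsByAutomorphisms Γ A)
    (o : V) :
    TranslationDuality.IsAssociationScheme (TranslationDuality.dualScheme Γ o E) ∧
    ∀ (n : ℕ) (b : Fin n → V) (C : Set (Fin n → V)), TranslationDuality.IsAdditive Γ b C →
      TranslationDuality.weightEnumerator (TranslationDuality.dualScheme Γ o E)
          (TranslationDuality.dualSet Γ b C) =
        TranslationDuality.dualWeightEnumerator E C ∧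
      ∀ φ : AddChar Γ ℂ ≃+ Γ,
        (∀ j χ ψ, TranslationDuality.dualScheme Γ o E j χ ψ =
          A j (φ χ +ᵥ o) (φ ψ +ᵥ o)) →
        TranslationDuality.weightEnumerator A
            (TranslationDuality.vertexSet b φ (TranslationDuality.dualSet Γ b C)) =
          TranslationDuality.dualWeightEnumerator E C := by
  obtain ⟨isScheme, duality⟩ := mainTheorem8_general A E hA hE hΓ o
  exact ⟨isScheme, fun n b C hC => ⟨(duality n b C hC).1, fun φ hφ =>
    (duality n b C hC).2 (fun k χ => φ χ +ᵥ b k) fun k j χ ψ =>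
      (hφ j χ ψ).trans (hΓ.apply_vadd_vadd_eq j o (b k) _ _)⟩⟩
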